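/- Let $\mathbb{F}$ be a field of characteristic zero, let $n\ge 0$, and let $\mathbf{d}=(d_1,\dots,d_n)$ be a list of $n$ nonnegative integers. Consider the ideal \[ I_{\mathbf d} = \bigl(x_1^{d_1+1},\dots,x_n^{d_n+1},\; x_1+\cdots+x_n\bigr)\subseteq \mathbb{F}[x_1,\dots,x_n] \] and its Macaulay inverse system \[ I_{\mathbf d}^\perp = \{\, g\in\mathbb{F}[x_1,\dots,x_n] : f(\partial/\partial x_1,\dots,\partial/\partial x_n)\,g = 0 \text{ for all } f\in I_{\mathbf d} \,\}. \] Let $\mathcal{T}_{\mathbf d}$ be the set of semistandard Young tableaux $T$ (rows weakly increasing, columns strictly increasing) of two-row rectangular shape $2\times m$, for any $m\ge 0$ (including the empty tableau), with entries in $\{1,\dots,n\}$ and at most $d_i$ entries equal to $i$ for each $1\le i\le n$. For $T\in\mathcal{T}_{\mathbf d}$ let \[ f_T = \prod_{(a<b)\text{ a column of }T} (x_a-x_b), \] the product running over the $m$ columns of $T$ with multiplicity (so $f_\varnothing = 1$). Then \[ I_{\mathbf d}^\perp = \operatorname{span}_{\mathbb{F}}\{\, f_T : T\in\mathcal{T}_{\mathbf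 d}\,\}. \] -/

import Mathlib

open MvPolynomial

namespace OneRow

/-- The differential operator `∂m = (∂/∂x_1)^{s_1} ⋯ (∂/∂x_n)^{s_n}` attached to the monomial
`m = x_1^{s_1} ⋯ x_n^{s_n}`. The endomorphism ring is noncommutative, so the product is written
as an ordered one (the factors commute with each other). -/
noncomputable def monomialDiff (F : Type*) [Field F] {n : ℕ} (s : Fin n →₀ ℕ) :
    Module.End F (MvPolynomial (Fin n) F) :=
  (List.ofFn fun i : Fin n =>
    ((pderiv i : Derivation F (MvPolynomial (Fin n) F) (MvPolynomial (Fin n) F)) :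
      Module.End F (MvPolynomial (Fin n) F)) ^ s i).prod

/-- The differential operator `∂f = f(∂/∂x_1, …, ∂/∂x_n)` attached to the polynomial `f`. -/
noncomputable def polyDiff {F : Type*} [Field F] {n : ℕ} (f : MvPolynomial (Fin n) F) :
    Module.End F (MvPolynomial (Fin n) F) :=
  ∑ s ∈ f.support, f.coeff s • monomialDiff F s

/-- The Macaulay inverse system `I^⊥ = {g | f ⊙ g = 0 for all f ∈ I}`, where
`f ⊙ g = (∂f)(g)`. -/
noncomputable def inverseSystem {F : Type*} [Field F] {n : ℕ}
    (I : Ideal (MvPolynomial (Fin n) F)) : Submodule F (MvPolynomial (Fin n) F) where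
  carrier := {g | ∀ f ∈ I, polyDiff f g = 0}
  zero_mem' := fun f _ => map_zero (polyDiff f)
  add_mem' := fun {a b} ha hb f hf => by
    rw [map_add, ha f hf, hb f hf, add_zero]
  smul_mem' := fun c a ha f hf => by
    rw [map_smul, ha f hf, smul_zero]

/-- The ideal `I_d = (x_1^{d_1 + 1}, …, x_n^{d_n + 1}, x_1 + ⋯ + x_n)`. -/
noncomputable def oneRowIdeal (F : Type*) [Field F] {n : ℕ} (d : Fin n → ℕ) :
    Ideal (MvPolynomial (Fin n) F) :=
  Ideal.span (Set.range (fun i : Fin n => (X i : MvPolynomial (Fin n) F) ^ (d i + 1)) ∪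
    {∑ i : Fin n, X i})

/-- The two-row rectangular Young diagram with `m` columns (empty for `m = 0`). -/
def twoRowRect (m : ℕ) : YoungDiagram where
  cells := Finset.range 2 ×ˢ Finset.range m
  isLowerSet := by
    rintro ⟨a, b⟩ ⟨a', b'⟩ ⟨h₁, h₂⟩ h
    simp only [Finset.coe_product, Set.mem_prod, Finset.mem_coe, Finset.mem_range] at h ⊢
    exact ⟨lt_of_le_of_lt h₁ h.1, lt_of_le_of_lt h₂ h.2⟩

theorem mem_twoRowRect {m i j : ℕ} : (i, j) ∈ twoRowRect m ↔ i < 2 ∧ j < m := by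
  rw [← YoungDiagram.mem_cells]
  simp [twoRowRect]

/-- Two-row rectangular semistandard Young tableaux, of any number of columns, with entries in an
alphabet of `n` letters. The letters are numbered `0, …, n - 1`, in accordance with the
numbering of the variables by `Fin n`. -/
structure TwoRowSSYT (n : ℕ) where
  /-- The number of columns. -/
  cols : ℕ
  /-- The tableau. -/
  tab : SemistandardYoungTableau (twoRowRect cols)
  /-- All entries are among the `n` letters. -/
  entry_lt : ∀ i j : ℕ, (i, j) ∈ twoRowRect cols → tab i j < n

/-- The letter in row `i` and column `j`. -/
def TwoRowSSYT.letter {n : ℕ} (T : TwoRowSSYT n) (i : Fin 2) (j : Fin T.cols) : Fin n :=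
  ⟨T.tab i j, T.entry_lt i j (mem_twoRowRect.mpr ⟨i.isLt, j.isLt⟩)⟩

/-- The number of boxes of `T` labeled by the letter `k`. -/
def TwoRowSSYT.content {n : ℕ} (T : TwoRowSSYT n) (k : Fin n) : ℕ :=
  (Finset.univ.filter fun c : Fin 2 × Fin T.cols => T.letter c.1 c.2 = k).card

/-- The polynomial `f_T = ∏ (x_a - x_b)`, over the columns `a < b` of `T` (with multiplicity). -/
noncomputable def TwoRowSSYT.poly (F : Type*) [Field F] {n : ℕ} (T : TwoRowSSYT n) :
    MvPolynomial (Fin n) F :=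
  ∏ j : Fin T.cols, (X (T.letter 0 j) - X (T.letter 1 j))

/-- The set of two-row rectangular SSYT which contain at most `d_k` copies of each letter `k`. -/
def boundedTableaux {n : ℕ} (d : Fin n → ℕ) : Set (TwoRowSSYT n) :=
  {T | ∀ k : Fin n, T.content k ≤ d k}

end OneRow

/-! In characteristic zero, the generators turn membership of `g` in the inverse system into two
conditions: `degreeOf i g ≤ d i` for every `i`, and `D g = 0`, where `D = ∑ ∂/∂x_i`
(`mem_inverseSystem_iff`). Every `f_T` satisfies both (`mem_columnSpan_imp`).

For spanning, let `u < v` be the two largest letters with `d ≠ 0`. Setting `x_v = x_u` in `g` gives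
a polynomial of the same kind with bound `d u + d v` at `u` and none of `v`, so by induction a
combination of tableau polynomials. In those tableaux `u` is the largest letter, hence only in the
second row and rightmost there; turning enough of these `u` into `v` lifts the combination to some
`h` in the span for `d` (`exists_split`). Then `g - h = (x_u - x_v) q`. The quotient `q` is again
killed by `D` and has bounds lowered by one at `u` and `v`, so induction applies, and multiplying by
`x_u - x_v` appends the column `(u, v)` on the right, which keeps tableaux semistandard
(`mul_mem_columnSpan`). -/

namespace OneRow

/-! ### Partial derivatives, degrees and translation invariance -/

section Derivations

variable {F : Type*} [Field F] {σ : Type*}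

theorem pderiv_commute (i j : σ) (g : MvPolynomial σ F) :
    pderiv i (pderiv j g) = pderiv j (pderiv i g) := by
  ext m
  classical
  simp only [coeff_pderiv, Finsupp.add_apply, Finsupp.single_apply]
  rw [add_right_comm]
  by_cases h : i = j
  · subst h; rfl
  · simp [h, Ne.symm h]; ring

/-- Differentiation multiplies the coefficients by exponents, and in characteristic zero a positive
exponent is nonzero, so no monomial involving `x_i` is lost. -/
theorem degreeOf_pderiv_le_iff [CharZero F] (i : σ) (k : ℕ) (g : MvPolynomial σ F) :
    degreeOf i (pderiv i g) ≤ k ↔ degreeOf i g ≤ k + 1 := by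
  simp only [degreeOf_le_iff, mem_support_iff, coeff_pderiv]
  constructor
  · intro h m hm
    by_contra! hlt
    have hm' : m - Finsupp.single i 1 + Finsupp.single i 1 = m :=
      tsub_add_cancel_of_le (by rw [Finsupp.single_le_iff]; omega)
    have h1 := h (m - Finsupp.single i 1) (by
      rw [hm']
      exact mul_ne_zero hm (Nat.cast_add_one_ne_zero _))
    simp at h1
    omega
  · intro h m hm
    have := h _ (left_ne_zero_of_mul hm)
    simpa using this

theorem pderiv_eq_zero_iff [CharZero F] (i : σ) (g : MvPolynomial σ F) :
    pderiv i g = 0 ↔ degreeOf i g = 0 := by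
  constructor
  · intro h
    rw [← Nat.le_zero, degreeOf_le_iff]
    intro m hm
    by_contra! hlt
    have hm' : m - Finsupp.single i 1 + Finsupp.single i 1 = m :=
      tsub_add_cancel_of_le (by rw [Finsupp.single_le_iff]; omega)
    have h1 := coeff_pderiv (i := i) g (m - Finsupp.single i 1)
    rw [h, hm', coeff_zero] at h1
    exact mul_ne_zero (mem_support_iff.mp hm) (Nat.cast_add_one_ne_zero _) h1.symm
  · intro h
    ext m
    rw [coeff_pderiv, coeff_zero]
    rw [← Nat.le_zero, degreeOf_le_iff] at h
    have : coeff (m + Finsupp.single i 1) g = 0 := by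
      by_contra hne
      simpa using h _ (mem_support_iff.mpr hne)
    rw [this, zero_mul]

theorem pderiv_pow_eq_zero_iff [CharZero F] (i : σ) (k : ℕ) (g : MvPolynomial σ F) :
    (((pderiv i : Derivation F (MvPolynomial σ F) (MvPolynomial σ F)) :
      Module.End F (MvPolynomial σ F)) ^ (k + 1)) g = 0 ↔ degreeOf i g ≤ k := by
  induction k generalizing g with
  | zero => simpa using pderiv_eq_zero_iff i g
  | succ k ih =>
    rw [pow_succ, Module.End.mul_apply, ih]
    exact degreeOf_pderiv_le_iff i k g

theorem eq_C_of_degreeOf_eq_zero {g : MvPolynomial σ F} (h : ∀ i, degreeOf i g = 0) :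
    g = C (coeff 0 g) := by
  classical
  ext m
  rw [coeff_C]
  split_ifs with hm
  · rw [hm]
  · by_contra hne
    refine hm (Finsupp.ext fun i => ?_).symm
    have := degreeOf_le_iff.mp (h i).le m (mem_support_iff.mpr hne)
    simpa using this

variable (F σ) in
/-- The derivation taking every variable to `1`, whose kernel consists of the
translation-invariant polynomials. -/
noncomputable def shiftDerivation : Derivation F (MvPolynomial σ F) (MvPolynomial σ F) :=
  mkDerivation F fun _ => 1

@[simp]
theorem shiftDerivation_X (i : σ) : shiftDerivation F σ (X i) = 1 :=
  mkDerivation_X _ _ _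

theorem shiftDerivation_apply [Fintype σ] (g : MvPolynomial σ F) :
    shiftDerivation F σ g = ∑ i, pderiv i g := by
  classical
  induction g using MvPolynomial.induction_on with
  | C a => simp
  | add p q hp hq => simp [hp, hq, Finset.sum_add_distrib]
  | mul_X p j hp =>
    simp [hp, Finset.sum_add_distrib, Finset.mul_sum, pderiv_X, Pi.single_apply]

theorem shiftDerivation_rename {τ : Type*} (f : σ → τ) (g : MvPolynomial σ F) :
    shiftDerivation F τ (rename f g) = rename f (shiftDerivation F σ g) := by
  induction g using MvPolynomial.induction_on with
  | C a => simp
  | add p q hp hq => simp [hp, hq]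
  | mul_X p j hp => simp [hp]

theorem eq_C_of_shiftDerivation_eq_zero [CharZero F] [Fintype σ] {g : MvPolynomial σ F} (w : σ)
    (hdeg : ∀ i, i ≠ w → degreeOf i g = 0) (hg : shiftDerivation F σ g = 0) :
    g = C (coeff 0 g) := by
  refine eq_C_of_degreeOf_eq_zero fun i => ?_
  by_cases h : i = w
  · subst h
    rw [← pderiv_eq_zero_iff, ← hg, shiftDerivation_apply, Finset.sum_eq_single i]
    · exact fun j _ hj => (pderiv_eq_zero_iff j g).mpr (hdeg j hj)
    · simp
  · exact hdeg i h

end Derivations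

/-! ### The inverse system as degree bounds and translation invariance -/

section InverseSystem

variable {F : Type*} [Field F] {n : ℕ}

/-- The commutative algebra of constant coefficient differential operators. -/
noncomputable abbrev diffAlgebra (F : Type*) [Field F] (n : ℕ) :
    Subalgebra F (Module.End F (MvPolynomial (Fin n) F)) :=
  Algebra.adjoin F (Set.range fun i : Fin n =>
    ((pderiv i : Derivation F (MvPolynomial (Fin n) F) (MvPolynomial (Fin n) F)) :
      Module.End F (MvPolynomial (Fin n) F)))

/-- `aeval` needs a commutative target, which `Module.End` is not; the subalgebra generated by the
commuting partial derivatives is. -/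
noncomputable instance : CommRing (diffAlgebra F n) where
  mul_comm := (Algebra.isMulCommutative_adjoin F (by
    rintro _ ⟨i, rfl⟩ _ ⟨j, rfl⟩
    exact LinearMap.ext fun g => pderiv_commute i j g)).is_comm.comm

/-- Substitution of the partial derivatives for the variables, as an algebra homomorphism. -/
noncomputable def diffHom (F : Type*) [Field F] (n : ℕ) :
    MvPolynomial (Fin n) F →ₐ[F] diffAlgebra F n :=
  aeval fun i => ⟨_, Algebra.subset_adjoin ⟨i, rfl⟩⟩

theorem polyDiff_eq_diffHom (f : MvPolynomial (Fin n) F) :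
    polyDiff f = (diffHom F n f : Module.End F (MvPolynomial (Fin n) F)) := by
  rw [diffHom, aeval_def, eval₂_eq', polyDiff]
  change _ = (diffAlgebra F n).val _
  rw [map_sum]
  refine Finset.sum_congr rfl fun s _ => ?_
  rw [← Algebra.smul_def, map_smul, ← List.prod_ofFn, map_list_prod, List.map_ofFn]
  rfl

/-- The operators annihilating `g` form an ideal `J`, so only the generators of `oneRowIdeal` need
testing. -/
theorem mem_inverseSystem_iff [CharZero F] (d : Fin n → ℕ) (g : MvPolynomial (Fin n) F) :
    g ∈ inverseSystem (oneRowIdeal F d) ↔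
      (∀ i, degreeOf i g ≤ d i) ∧ shiftDerivation F (Fin n) g = 0 := by
  let J : Ideal (MvPolynomial (Fin n) F) :=
    { carrier := {f | polyDiff f g = 0}
      zero_mem' := by simp [polyDiff_eq_diffHom]
      add_mem' := fun {a b} ha hb => by
        simp only [Set.mem_ofPred_eq, polyDiff_eq_diffHom, map_add] at ha hb ⊢
        simp [ha, hb]
      smul_mem' := fun c a ha => by
        simp only [Set.mem_ofPred_eq, polyDiff_eq_diffHom, smul_eq_mul, map_mul] at ha ⊢
        simp [ha] }
  have hJ : g ∈ inverseSystem (oneRowIdeal F d) ↔ oneRowIdeal F d ≤ J := Iff.rfl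
  have hX : ∀ i : Fin n, (diffHom F n (X i) : Module.End F (MvPolynomial (Fin n) F)) =
      (pderiv i : Derivation F (MvPolynomial (Fin n) F) (MvPolynomial (Fin n) F)) := fun i => by
    rw [diffHom, aeval_X]
  have hpow : ∀ i : Fin n, (X i : MvPolynomial (Fin n) F) ^ (d i + 1) ∈ J ↔
      degreeOf i g ≤ d i := fun i => by
    change polyDiff _ g = 0 ↔ _
    rw [polyDiff_eq_diffHom, map_pow, SubmonoidClass.coe_pow, hX, pderiv_pow_eq_zero_iff]
  have hsum : (∑ i, X i : MvPolynomial (Fin n) F) ∈ J ↔ shiftDerivation F (Fin n) g = 0 := by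
    change polyDiff _ g = 0 ↔ _
    rw [polyDiff_eq_diffHom, map_sum, AddSubmonoidClass.coe_finsetSum, shiftDerivation_apply]
    simp [hX]
  rw [hJ, oneRowIdeal, Ideal.span_le, Set.union_subset_iff, Set.range_subset_iff,
    Set.singleton_subset_iff]
  exact and_congr (forall_congr' hpow) hsum

end InverseSystem

/-! ### Semistandard column lists and the splitting of the largest letter -/

section Columns

variable {σ : Type*} (F : Type*) [Field F]

/-- The product of the `x_a - x_b` over a list of columns. -/
noncomputable def columnPoly (L : List (σ × σ)) : MvPolynomial σ F :=
  (L.map fun p => X p.1 - X p.2).prod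

variable {F}

theorem columnPoly_cons (p : σ × σ) (L : List (σ × σ)) :
    columnPoly F (p :: L) = (X p.1 - X p.2) * columnPoly F L := by
  simp [columnPoly]

theorem columnPoly_append (L L' : List (σ × σ)) :
    columnPoly F (L ++ L') = columnPoly F L * columnPoly F L' := by
  simp [columnPoly]

theorem shiftDerivation_columnPoly (L : List (σ × σ)) :
    shiftDerivation F σ (columnPoly F L) = 0 := by
  induction L with
  | nil => simp [columnPoly]
  | cons p L ih => simp [columnPoly_cons, ih]

variable [LinearOrder σ]

/-- A list of columns `a < b`, read from right to left, whose rows are weakly increasing. -/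
structure IsColumnList (L : List (σ × σ)) : Prop where
  lt : ∀ p ∈ L, p.1 < p.2
  sorted : L.Pairwise fun p q => q ≤ p

/-- The number of boxes labeled `k` in a list of columns. -/
def columnCount (L : List (σ × σ)) (k : σ) : ℕ :=
  (L.map Prod.fst).count k + (L.map Prod.snd).count k

/-- The span of the polynomials of the semistandard lists of columns with content at most `d`. -/
noncomputable def columnSpan (F : Type*) [Field F] (d : σ → ℕ) : Submodule F (MvPolynomial σ F) :=
  Submodule.span F {f | ∃ L, IsColumnList L ∧ (∀ k, columnCount L k ≤ d k) ∧ columnPoly F L = f}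

theorem columnCount_cons (p : σ × σ) (L : List (σ × σ)) (k : σ) :
    columnCount (p :: L) k =
      columnCount L k + ((if p.1 = k then 1 else 0) + (if p.2 = k then 1 else 0)) := by
  simp only [columnCount, List.map_cons, List.count_cons, beq_iff_eq]
  omega

theorem columnCount_append (L L' : List (σ × σ)) (k : σ) :
    columnCount (L ++ L') k = columnCount L k + columnCount L' k := by
  simp only [columnCount, List.map_append, List.count_append]
  omega

theorem one_le_columnCount {L : List (σ × σ)} {p : σ × σ} (hp : p ∈ L) :
    1 ≤ columnCount L p.1 ∧ 1 ≤ columnCount L p.2 := by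
  have h1 := List.one_le_count_iff.mpr (List.mem_map_of_mem (f := Prod.fst) hp)
  have h2 := List.one_le_count_iff.mpr (List.mem_map_of_mem (f := Prod.snd) hp)
  simp only [columnCount]
  omega

theorem degreeOf_columnPoly_le (L : List (σ × σ)) (k : σ) :
    degreeOf k (columnPoly F L) ≤ columnCount L k := by
  induction L with
  | nil => simp [columnPoly, columnCount]
  | cons p L ih =>
    rw [columnPoly_cons, columnCount_cons, add_comm]
    refine (degreeOf_mul_le _ _ _).trans (add_le_add ?_ ih)
    refine (degreeOf_sub_le _ _ _).trans ?_
    rw [degreeOf_X, degreeOf_X]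
    simp only [eq_comm (a := k)]
    exact max_le (Nat.le_add_right _ _) (Nat.le_add_left _ _)

theorem mem_columnSpan_imp {d : σ → ℕ} {g : MvPolynomial σ F} (hg : g ∈ columnSpan F d) :
    (∀ i, degreeOf i g ≤ d i) ∧ shiftDerivation F σ g = 0 := by
  induction hg using Submodule.span_induction with
  | mem f hf =>
    obtain ⟨L, -, hL, rfl⟩ := hf
    exact ⟨fun i => (degreeOf_columnPoly_le L i).trans (hL i), shiftDerivation_columnPoly L⟩
  | zero => simp
  | add f g _ _ hf hg =>
    exact ⟨fun i => (degreeOf_add_le i f g).trans (max_le (hf.1 i) (hg.1 i)), by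
      rw [map_add, hf.2, hg.2, add_zero]⟩
  | smul c f _ hf =>
    refine ⟨fun i => ?_, by rw [Derivation.map_smul, hf.2, smul_zero]⟩
    rw [smul_eq_C_mul]
    exact (degreeOf_C_mul_le f i c).trans (hf.1 i)

theorem C_mem_columnSpan (d : σ → ℕ) (a : F) : C a ∈ columnSpan F d := by
  have h1 : (1 : MvPolynomial σ F) ∈ columnSpan F d :=
    Submodule.subset_span ⟨[], ⟨by simp, by simp⟩, by simp [columnCount], by simp [columnPoly]⟩
  simpa [smul_eq_C_mul] using Submodule.smul_mem _ a h1

/-- Appending the column of the two largest available letters. -/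
theorem mul_mem_columnSpan {d e : σ → ℕ} {u v : σ} (huv : u < v)
    (htop : ∀ i, d i ≠ 0 → i ≤ v) (hsub : ∀ i, d i ≠ 0 → i < v → i ≤ u)
    (hed : ∀ k, e k + ((if u = k then 1 else 0) + (if v = k then 1 else 0)) ≤ d k)
    {q : MvPolynomial σ F} (hq : q ∈ columnSpan F e) :
    (X u - X v) * q ∈ columnSpan F d := by
  induction hq using Submodule.span_induction with
  | mem f hf =>
    obtain ⟨L, hL, hc, rfl⟩ := hf
    -- Lists run from right to left, so the new rightmost column is the head.
    refine Submodule.subset_span ⟨(u, v) :: L, ⟨?_, ?_⟩, fun k => ?_, columnPoly_cons _ _⟩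
    · simpa [huv] using hL.lt
    · refine List.pairwise_cons.mpr ⟨fun p hp => ?_, hL.sorted⟩
      -- A letter that occurs in `L` has `d ≠ 0`, so `p.2 ≤ v`; then `p.1 < p.2 ≤ v` forces `p.1 ≤
      -- u`.
      obtain ⟨h1, h2⟩ := one_le_columnCount hp
      have h3 := hc p.1
      have h4 := hc p.2
      have h5 := hed p.1
      have h6 := hed p.2
      have hv := htop p.2 (by omega)
      exact ⟨hsub p.1 (by omega) ((hL.lt p hp).trans_le hv), hv⟩
    · rw [columnCount_cons]
      exact (Nat.add_le_add_right (hc k) _).trans (hed k)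
  | zero => simp
  | add f g _ _ hf hg => rw [mul_add]; exact add_mem hf hg
  | smul c f _ hf => rw [mul_smul_comm]; exact Submodule.smul_mem _ c hf

/-- The copies of the maximum `u` form an initial segment, so they are dropped first. -/
theorem count_drop_of_sorted {u : σ} {l : List σ} (hs : l.Pairwise fun a b => b ≤ a)
    (hu : ∀ a ∈ l, a ≤ u) (b : ℕ) : (l.drop b).count u = l.count u - b := by
  induction l generalizing b with
  | nil => simp
  | cons a l ih =>
    obtain ⟨h1, h2⟩ := List.pairwise_cons.mp hs
    cases b with
    | zero => simp
    | succ b =>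
      rw [List.drop_succ_cons, ih h2 fun c hc => hu c (List.mem_cons_of_mem _ hc)]
      by_cases ha : a = u
      · subst ha; simp
      · have : l.count u = 0 := List.count_eq_zero.mpr fun hmem =>
          ha (le_antisymm (hu a List.mem_cons_self) (h1 u hmem))
        rw [List.count_cons_of_ne ha, this]; omega

/-- Replace the letter `u` by `v` in the second row of a column. -/
def raiseSnd (u v : σ) (p : σ × σ) : σ × σ := (p.1, if p.2 = u then v else p.2)

/-- The identification of the letter `v` with the letter `u`. -/
def mergeLetter (u v : σ) (i : σ) : σ := if i = v then u else i

theorem rename_mergeLetter_columnPoly_raiseSnd {u v : σ} {L : List (σ × σ)}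
    (hL : ∀ p ∈ L, p.1 ≠ v ∧ p.2 ≠ v) :
    rename (mergeLetter u v) (columnPoly F (L.map (raiseSnd u v))) = columnPoly F L := by
  induction L with
  | nil => simp [columnPoly]
  | cons p L ih =>
    obtain ⟨h1, h2⟩ := hL p List.mem_cons_self
    rw [List.map_cons, columnPoly_cons, columnPoly_cons, map_mul,
      ih fun q hq => hL q (List.mem_cons_of_mem _ hq)]
    congr 1
    by_cases h : p.2 = u <;> simp [raiseSnd, mergeLetter, h1, h2, h]

theorem rename_mergeLetter_columnPoly {u v : σ} {L : List (σ × σ)}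
    (hL : ∀ p ∈ L, p.1 ≠ v ∧ p.2 ≠ v) :
    rename (mergeLetter u v) (columnPoly F L) = columnPoly F L := by
  induction L with
  | nil => simp [columnPoly]
  | cons p L ih =>
    obtain ⟨h1, h2⟩ := hL p List.mem_cons_self
    rw [columnPoly_cons, map_mul, ih fun q hq => hL q (List.mem_cons_of_mem _ hq)]
    simp [mergeLetter, h1, h2]

theorem columnCount_raiseSnd_of_ne {u v k : σ} (hu : k ≠ u) (hv : k ≠ v) (L : List (σ × σ)) :
    columnCount (L.map (raiseSnd u v)) k = columnCount L k := by
  induction L with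
  | nil => rfl
  | cons p L ih =>
    rw [List.map_cons, columnCount_cons, columnCount_cons, ih]
    by_cases h : p.2 = u <;> simp [raiseSnd, h, hu.symm, hv.symm]

theorem columnCount_raiseSnd_left {u v : σ} (huv : u ≠ v) {L : List (σ × σ)}
    (hL : ∀ p ∈ L, p.1 ≠ u) : columnCount (L.map (raiseSnd u v)) u = 0 := by
  induction L with
  | nil => rfl
  | cons p L ih =>
    rw [List.map_cons, columnCount_cons, ih fun q hq => hL q (List.mem_cons_of_mem _ hq)]
    have := hL p List.mem_cons_self
    by_cases h : p.2 = u <;> simp [raiseSnd, h, huv.symm, this]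

theorem columnCount_raiseSnd_right_le {u v : σ} {L : List (σ × σ)}
    (hL : ∀ p ∈ L, p.1 ≠ v) : columnCount (L.map (raiseSnd u v)) v ≤ L.length := by
  have h0 : ((L.map (raiseSnd u v)).map Prod.fst).count v = 0 := by
    refine List.count_eq_zero.mpr fun hmem => ?_
    simp only [List.map_map, List.mem_map, Function.comp_apply, raiseSnd] at hmem
    obtain ⟨p, hp, h⟩ := hmem
    exact hL p hp h
  rw [columnCount, h0, zero_add]
  exact List.count_le_length.trans (by simp)

theorem columnCount_eq_zero {k : σ} {L : List (σ × σ)} (hL : ∀ p ∈ L, p.1 ≠ k ∧ p.2 ≠ k) :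
    columnCount L k = 0 := by
  induction L with
  | nil => rfl
  | cons p L ih =>
    obtain ⟨h1, h2⟩ := hL p List.mem_cons_self
    rw [columnCount_cons, ih fun q hq => hL q (List.mem_cons_of_mem _ hq)]
    simp [h1, h2]

theorem columnCount_eq_count_snd {k : σ} {L : List (σ × σ)} (hL : ∀ p ∈ L, p.1 ≠ k) :
    columnCount L k = (L.map Prod.snd).count k := by
  rw [columnCount, List.count_eq_zero.mpr, zero_add]
  intro hmem
  obtain ⟨p, hp, h⟩ := List.mem_map.mp hmem
  exact hL p hp h

/-- Splitting the largest letter `u` of a semistandard list of columns into `u` and `v`. -/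
theorem exists_split {u v : σ} (huv : u < v) {L : List (σ × σ)} (hL : IsColumnList L)
    (hu : ∀ p ∈ L, p.2 ≤ u) {a b : ℕ} (hc : columnCount L u ≤ a + b) :
    ∃ L', IsColumnList L' ∧ columnCount L' u ≤ a ∧ columnCount L' v ≤ b ∧
      (∀ k, k ≠ u → k ≠ v → columnCount L' k = columnCount L k) ∧
      rename (mergeLetter u v) (columnPoly F L') = columnPoly F L := by
  have hne : ∀ p ∈ L, p.1 ≠ v ∧ p.2 ≠ v := fun p hp =>
    ⟨(((hL.lt p hp).trans_le (hu p hp)).trans huv).ne, ((hu p hp).trans_lt huv).ne⟩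
  have hne' : ∀ p ∈ L, p.1 ≠ u := fun p hp => ((hL.lt p hp).trans_le (hu p hp)).ne
  have ht : ∀ p ∈ L.take b, p ∈ L := fun p hp => List.mem_of_mem_take hp
  have hd : ∀ p ∈ L.drop b, p ∈ L := fun p hp => List.mem_of_mem_drop hp
  have hle : ∀ p, p.2 ≤ (raiseSnd u v p).2 := fun p => by
    by_cases h : p.2 = u
    · simpa [raiseSnd, h] using huv.le
    · simp [raiseSnd, h]
  have hmono : ∀ p ∈ L, ∀ q ∈ L, q ≤ p → raiseSnd u v q ≤ raiseSnd u v p := by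
    intro p hp q hq hqp
    refine ⟨hqp.1, ?_⟩
    by_cases h : q.2 = u
    · have : p.2 = u := le_antisymm (hu p hp) (h ▸ hqp.2)
      simp [raiseSnd, h, this]
    · have : (raiseSnd u v q).2 = q.2 := by simp [raiseSnd, h]
      rw [this]
      exact hqp.2.trans (hle p)
  have hsplit := hL.sorted
  rw [← List.take_append_drop b L, List.pairwise_append] at hsplit
  -- Raise `u` to `v` in the `b` rightmost columns. The copies of `u` come first in the list, so at
  -- most `a` of them remain, and at most `b` copies of `v` appear.
  refine ⟨(L.take b).map (raiseSnd u v) ++ L.drop b, ⟨?_, ?_⟩, ?_, ?_, ?_, ?_⟩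
  · intro p hp
    rw [List.mem_append, List.mem_map] at hp
    rcases hp with ⟨q, hq, rfl⟩ | hp
    · exact (hL.lt q (ht q hq)).trans_le (hle q)
    · exact hL.lt p (hd p hp)
  · refine List.pairwise_append.mpr ⟨?_, hsplit.2.1, ?_⟩
    · rw [List.pairwise_map]
      exact hsplit.1.imp_of_mem fun hp hq h => hmono _ (ht _ hp) _ (ht _ hq) h
    · intro p hp q hq
      obtain ⟨p, hp', rfl⟩ := List.mem_map.mp hp
      have := hsplit.2.2 p hp' q hq
      exact ⟨this.1, this.2.trans (hle p)⟩
  · rw [columnCount_append, columnCount_raiseSnd_left huv.ne fun p hp => hne' p (ht p hp),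
      columnCount_eq_count_snd fun p hp => hne' p (hd p hp), List.map_drop,
      count_drop_of_sorted (List.pairwise_map.mpr (hL.sorted.imp fun h => h.2))
        (by simpa using fun x y hp => hu _ hp),
      ← columnCount_eq_count_snd hne']
    omega
  · rw [columnCount_append, columnCount_eq_zero fun p hp => hne p (hd p hp), add_zero]
    exact (columnCount_raiseSnd_right_le fun p hp => (hne p (ht p hp)).1).trans
      (List.length_take_le _ _)
  · intro k hku hkv
    rw [columnCount_append, columnCount_raiseSnd_of_ne hku hkv, ← columnCount_append,
      List.take_append_drop]
  · rw [columnPoly_append, map_mul,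
      rename_mergeLetter_columnPoly_raiseSnd fun p hp => hne p (ht p hp),
      rename_mergeLetter_columnPoly fun p hp => hne p (hd p hp), ← columnPoly_append,
      List.take_append_drop]

end Columns

/-! ### Spanning by merging the two largest letters -/

section Spanning

variable {F : Type*} [Field F] {σ : Type*} [LinearOrder σ]

/-- Modulo `X u - X v`, merging is the identity. -/
theorem dvd_of_rename_mergeLetter_eq_zero {u v : σ} {g : MvPolynomial σ F}
    (hg : rename (mergeLetter u v) g = 0) : X u - X v ∣ g := by
  let I : Ideal (MvPolynomial σ F) := Ideal.span {X u - X v}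
  have h : (Ideal.Quotient.mkₐ F I).comp (rename (mergeLetter u v)) = Ideal.Quotient.mkₐ F I := by
    refine algHom_ext fun i => ?_
    by_cases hi : i = v
    · simp only [AlgHom.comp_apply, rename_X, mergeLetter, hi, if_true]
      exact Ideal.Quotient.eq.mpr (Ideal.mem_span_singleton_self _)
    · simp [mergeLetter, hi]
  have h' := DFunLike.congr_fun h g
  rw [AlgHom.comp_apply, hg, map_zero] at h'
  exact Ideal.mem_span_singleton.mp (Ideal.Quotient.eq_zero_iff_mem.mp h'.symm)

/-- The degree bounds after identification of `v` with `u`. -/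
def mergeBound (u v : σ) (d : σ → ℕ) (i : σ) : ℕ :=
  if i = v then 0 else if i = u then d u + d v else d i

/-- Every polynomial with the merged degree bounds in the span is the image under the merging of
one with the original degree bounds. -/
theorem exists_lift_of_mem_columnSpan {d : σ → ℕ} {u v : σ} (huv : u < v)
    (htop : ∀ i, d i ≠ 0 → i ≤ v) (hsub : ∀ i, d i ≠ 0 → i < v → i ≤ u)
    {f : MvPolynomial σ F} (hf : f ∈ columnSpan F (mergeBound u v d)) :
    ∃ h ∈ columnSpan F d, rename (mergeLetter u v) h = f := by
  suffices H : columnSpan F (mergeBound u v d) ≤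
      (columnSpan F d).map (rename (R := F) (mergeLetter u v)).toLinearMap by
    obtain ⟨h, hh, rfl⟩ := H hf
    exact ⟨h, hh, rfl⟩
  refine Submodule.span_le.mpr ?_
  rintro _ ⟨L, hL, hc, rfl⟩
  -- The merged bound vanishes at `v` and above it, so `u` is the largest letter allowed.
  have hu : ∀ p ∈ L, p.2 ≤ u := by
    intro p hp
    have h1 := (one_le_columnCount hp).2.trans (hc p.2)
    by_contra! hlt
    by_cases hv : p.2 = v
    · simp [mergeBound, hv] at h1
    · rw [mergeBound, if_neg hv, if_neg hlt.ne'] at h1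
      exact hlt.not_ge (hsub _ (by omega) ((htop _ (by omega)).lt_of_ne hv))
  have hcu : columnCount L u ≤ d u + d v := by simpa [mergeBound, huv.ne] using hc u
  obtain ⟨L', hL', h1, h2, h3, h4⟩ := exists_split (F := F) huv hL hu hcu
  refine ⟨columnPoly F L', Submodule.subset_span ⟨L', hL', fun k => ?_, rfl⟩, h4⟩
  by_cases hku : k = u
  · rwa [hku]
  · by_cases hkv : k = v
    · rwa [hkv]
    · rw [h3 k hku hkv]
      simpa [mergeBound, hku, hkv] using hc k

/-- Over a field, degrees in each variable add under multiplication of nonzero polynomials. -/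
theorem degreeOf_le_of_mul {u v : σ} (huv : u ≠ v) {d : σ → ℕ} {q : MvPolynomial σ F}
    (hq0 : q ≠ 0) (hq : ∀ i, degreeOf i ((X u - X v) * q) ≤ d i) (k : σ) :
    degreeOf k q + ((if u = k then 1 else 0) + (if v = k then 1 else 0)) ≤ d k := by
  have hne : (X u - X v : MvPolynomial σ F) ≠ 0 := sub_ne_zero.mpr fun h => huv (X_injective h)
  have h := hq k
  rw [degreeOf_mul_eq hne hq0] at h
  suffices (if u = k then 1 else 0) + (if v = k then 1 else 0) ≤
      degreeOf k (X u - X v : MvPolynomial σ F) by omega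
  have key : ∀ a b : σ, a ≠ b → 1 ≤ degreeOf a (X a - X b : MvPolynomial σ F) := by
    intro a b hab
    have hmem : Finsupp.single a 1 ∈ (X a - X b : MvPolynomial σ F).support := by
      rw [mem_support_iff, coeff_sub, coeff_X, coeff_X, if_pos rfl, if_neg, sub_zero]
      · exact one_ne_zero
      · intro h
        exact hab (Finsupp.single_left_injective one_ne_zero h).symm
    simpa using degreeOf_le_iff.mp (le_refl (degreeOf a (X a - X b : MvPolynomial σ F))) _ hmem
  by_cases hu : u = k
  · subst hu
    simpa [huv.symm] using key u v huv
  · by_cases hv : v = k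
    · subst hv
      have := key v u huv.symm
      rw [← neg_sub, degreeOf_neg] at this
      simpa [huv] using this
    · simp [hu, hv]

variable [Fintype σ]

theorem degreeOf_rename_mergeLetter_le {u v : σ} (huv : u ≠ v) {d : σ → ℕ}
    {g : MvPolynomial σ F} (hg : ∀ i, degreeOf i g ≤ d i) (i : σ) :
    degreeOf i (rename (mergeLetter u v) g) ≤ mergeBound u v d i := by
  rw [degreeOf_le_iff]
  intro m hm
  obtain ⟨s, rfl, hs⟩ := coeff_rename_ne_zero _ _ _ (mem_support_iff.mp hm)
  have hsd : ∀ j, s j ≤ d j := fun j => degreeOf_le_iff.mp (hg j) s (mem_support_iff.mpr hs)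
  rw [Finsupp.mapDomain, Finsupp.sum_apply, Finsupp.sum_fintype _ _ (by simp)]
  simp only [Finsupp.single_apply, mergeLetter]
  by_cases hiv : i = v
  · subst hiv
    refine le_of_eq_of_le (Finset.sum_eq_zero fun j _ => ?_) (Nat.zero_le _)
    by_cases hj : j = i <;> simp [hj, huv]
  · by_cases hiu : i = u
    · subst hiu
      rw [mergeBound, if_neg hiv, if_pos rfl]
      refine le_trans (le_of_eq ?_) (add_le_add (hsd i) (hsd v))
      rw [← Finset.sum_pair (f := fun j => s j) huv, ← Finset.sum_subset (Finset.subset_univ {i, v})]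
      · refine Finset.sum_congr rfl fun j hj => ?_
        rw [Finset.mem_insert, Finset.mem_singleton] at hj
        rcases hj with rfl | rfl <;> simp
      · intro j _ hj
        rw [Finset.mem_insert, Finset.mem_singleton, not_or] at hj
        simp [hj]
    · rw [mergeBound, if_neg hiv, if_neg hiu]
      refine le_trans (le_of_eq ?_) (hsd i)
      rw [Finset.sum_eq_single i]
      · simp [hiv]
      · intro j _ hj
        by_cases hjv : j = v
        · simp [hjv, Ne.symm hiu]
        · simp [hjv, hj]
      · simp

theorem sum_mergeBound {u v : σ} (huv : u ≠ v) (d : σ → ℕ) :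
    ∑ i, mergeBound u v d i = ∑ i, d i := by
  have h : ∀ i, mergeBound u v d i + (if i = v then d v else 0) =
      d i + (if i = u then d v else 0) := by
    intro i
    by_cases hv : i = v
    · subst hv; simp [mergeBound, huv.symm]
    · by_cases hu : i = u
      · subst hu; simp [mergeBound, hv]
      · simp [mergeBound, hv, hu]
  have := Finset.sum_congr (rfl : (Finset.univ : Finset σ) = Finset.univ) fun i _ => h i
  simpa [Finset.sum_add_distrib] using this

/-- Translation-invariant polynomials with bounded degree in every variable are spanned by the
polynomials of semistandard lists of columns. -/
theorem mem_columnSpan_of_shiftDerivation_eq_zero [CharZero F] {d : σ → ℕ}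
    {g : MvPolynomial σ F} (hdeg : ∀ i, degreeOf i g ≤ d i)
    (hg : shiftDerivation F σ g = 0) : g ∈ columnSpan F d := by
  -- Merging keeps the sum of `d` but removes `v` from its support; dividing by `X u - X v` lowers
  -- the sum. Their total drops in both cases.
  induction hN : ∑ i, d i + (Finset.univ.filter fun i => d i ≠ 0).card
    using Nat.strong_induction_on generalizing d g with
  | _ N ih =>
  subst hN
  set S := Finset.univ.filter fun i => d i ≠ 0 with hS
  have hmemS : ∀ i, i ∈ S ↔ d i ≠ 0 := fun i => by simp [hS]
  rcases S.eq_empty_or_nonempty with hSe | hSne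
  · rw [eq_C_of_degreeOf_eq_zero fun i => Nat.le_zero.mp ((hdeg i).trans
      (le_of_eq (not_not.mp fun h => by simpa [hSe] using (hmemS i).mpr h)))]
    exact C_mem_columnSpan _ _
  set v := S.max' hSne with hv
  have hvS : v ∈ S := S.max'_mem hSne
  have htop : ∀ i, d i ≠ 0 → i ≤ v := fun i hi => S.le_max' i ((hmemS i).mpr hi)
  rcases (S.erase v).eq_empty_or_nonempty with hSe | hSne'
  -- With a single available letter, `D` acts on `g` as the derivative in `x_v`, so `g` is constant.
  · rw [eq_C_of_shiftDerivation_eq_zero v (fun i hi => Nat.le_zero.mp ((hdeg i).trans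
      (le_of_eq (not_not.mp fun h => by
        simpa [hSe] using Finset.mem_erase.mpr ⟨hi, (hmemS i).mpr h⟩)))) hg]
    exact C_mem_columnSpan _ _
  set u := (S.erase v).max' hSne' with hu
  have huS : u ∈ S.erase v := (S.erase v).max'_mem hSne'
  have huv : u < v :=
    lt_of_le_of_ne (S.le_max' u (Finset.mem_of_mem_erase huS)) (Finset.ne_of_mem_erase huS)
  have hsub : ∀ i, d i ≠ 0 → i < v → i ≤ u := fun i hi hiv =>
    (S.erase v).le_max' i (Finset.mem_erase.mpr ⟨hiv.ne, (hmemS i).mpr hi⟩)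
  have hdu : d u ≠ 0 := (hmemS u).mp (Finset.mem_of_mem_erase huS)
  have hdv : d v ≠ 0 := (hmemS v).mp hvS
  have hmerge : rename (mergeLetter u v) g ∈ columnSpan F (mergeBound u v d) := by
    refine ih _ ?_ (degreeOf_rename_mergeLetter_le huv.ne hdeg)
      (by rw [shiftDerivation_rename, hg, map_zero]) rfl
    rw [sum_mergeBound huv.ne]
    refine Nat.add_lt_add_left (Finset.card_lt_card (Finset.ssubset_iff_of_subset ?_ |>.mpr
      ⟨v, hvS, by simp [mergeBound]⟩)) _
    intro i hi
    rw [Finset.mem_filter] at hi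
    rw [hmemS]
    intro h0
    refine hi.2 ?_
    by_cases hiu : i = u
    · exact absurd (hiu ▸ h0) hdu
    · simp [mergeBound, hiu, h0]
  obtain ⟨h, hh, hhg⟩ := exists_lift_of_mem_columnSpan huv htop hsub hmerge
  obtain ⟨hhdeg, hhD⟩ := mem_columnSpan_imp hh
  obtain ⟨q, hq⟩ := dvd_of_rename_mergeLetter_eq_zero (u := u) (v := v) (g := g - h)
    (by rw [map_sub, hhg, sub_self])
  suffices (X u - X v) * q ∈ columnSpan F d by
    rw [← sub_add_cancel g h, hq]
    exact add_mem this hh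
  by_cases hq0 : q = 0
  · simp [hq0]
  have hqdeg := degreeOf_le_of_mul huv.ne hq0 (d := d) fun i => by
    rw [← hq]
    exact (degreeOf_sub_le i g h).trans (max_le (hdeg i) (hhdeg i))
  have hqD : shiftDerivation F σ q = 0 := by
    -- Since `D (X u - X v) = 0`, the Leibniz rule leaves `(X u - X v) * D q = 0`.
    have h1 : shiftDerivation F σ ((X u - X v) * q) = 0 := by
      rw [← hq, map_sub, hg, hhD, sub_zero]
    have hne : (X u - X v : MvPolynomial σ F) ≠ 0 :=
      sub_ne_zero.mpr fun h => huv.ne (X_injective h)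
    simpa [hne] using h1
  let e : σ → ℕ := fun k => d k - ((if u = k then 1 else 0) + (if v = k then 1 else 0))
  have hed : ∀ k, e k + ((if u = k then 1 else 0) + (if v = k then 1 else 0)) ≤ d k :=
    fun k => (Nat.sub_add_cancel (le_trans (Nat.le_add_left _ _) (hqdeg k))).le
  refine mul_mem_columnSpan huv htop hsub hed (ih _ ?_ (fun k => Nat.le_sub_of_add_le (hqdeg k))
    hqD rfl)
  have hle : ∀ k, e k ≤ d k := fun k => Nat.sub_le _ _
  refine Nat.add_lt_add_of_lt_of_le (Finset.sum_lt_sum (fun k _ => hle k)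
    ⟨u, Finset.mem_univ u, ?_⟩) (Finset.card_le_card fun k hk => ?_)
  · have := hed u
    simp only [if_true] at this
    omega
  · rw [Finset.mem_filter] at hk
    rw [hmemS]
    have := hle k
    omega

end Spanning

/-! ### Column lists and two-row tableaux -/

section Tableaux

variable {F : Type*} [Field F] {n : ℕ}

/-- The columns of a tableau, from right to left. -/
def TwoRowSSYT.columnList (T : TwoRowSSYT n) : List (Fin n × Fin n) :=
  List.ofFn fun j : Fin T.cols => (T.letter 0 j.rev, T.letter 1 j.rev)

theorem columnPoly_columnList (T : TwoRowSSYT n) : columnPoly F T.columnList = T.poly F := by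
  rw [columnPoly, TwoRowSSYT.columnList, List.map_ofFn, List.prod_ofFn, TwoRowSSYT.poly]
  exact Equiv.prod_comp Fin.revPerm fun j =>
    (X (T.letter 0 j) - X (T.letter 1 j) : MvPolynomial (Fin n) F)

theorem count_ofFn {α : Type*} [DecidableEq α] {m : ℕ} (f : Fin m → α) (a : α) :
    (List.ofFn f).count a = ∑ j, if f j = a then 1 else 0 := by
  induction m with
  | zero => simp
  | succ m ih =>
    rw [List.ofFn_succ, List.count_cons, ih, Fin.sum_univ_succ, add_comm]
    simp

theorem columnCount_columnList (T : TwoRowSSYT n) (k : Fin n) :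
    columnCount T.columnList k = T.content k := by
  have hcount : ∀ i : Fin 2, (List.ofFn fun j : Fin T.cols => T.letter i j.rev).count k =
      ∑ j : Fin T.cols, if T.letter i j = k then 1 else 0 := fun i => by
    rw [count_ofFn]
    exact Equiv.sum_comp Fin.revPerm fun j => if T.letter i j = k then 1 else 0
  rw [columnCount, TwoRowSSYT.columnList, List.map_ofFn, List.map_ofFn, TwoRowSSYT.content,
    Finset.card_filter, Fintype.sum_prod_type, Fin.sum_univ_two]
  exact congrArg₂ (· + ·) (hcount 0) (hcount 1)

theorem isColumnList_columnList (T : TwoRowSSYT n) : IsColumnList T.columnList where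
  lt := by
    intro p hp
    obtain ⟨j, rfl⟩ := (List.mem_ofFn' _ _).mp hp
    exact T.tab.col_strict Nat.zero_lt_one (mem_twoRowRect.mpr ⟨by decide, Fin.isLt _⟩)
  sorted := by
    rw [TwoRowSSYT.columnList, List.pairwise_ofFn]
    intro i j hij
    have h : j.rev < i.rev := Fin.rev_lt_rev.mpr hij
    exact ⟨T.tab.row_weak h (mem_twoRowRect.mpr ⟨by decide, Fin.isLt _⟩),
      T.tab.row_weak h (mem_twoRowRect.mpr ⟨by decide, Fin.isLt _⟩)⟩

/-- The letter in row `i` and column `j` of a tableau given by its list of columns. -/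
def columnEntry (L : List (Fin n × Fin n)) (i j : ℕ) : ℕ :=
  -- Tableau columns are numbered from the left, hence the reversal; entries outside the diagram
  -- must be `0`.
  if h : i < 2 ∧ j < L.length then
    (if i = 0 then (L.reverse[j]'(by simpa using h.2)).1
      else (L.reverse[j]'(by simpa using h.2)).2 : Fin n)
  else 0

/-- The tableau with a given semistandard list of columns. -/
def IsColumnList.tableau {L : List (Fin n × Fin n)} (hL : IsColumnList L) : TwoRowSSYT n where
  cols := L.length
  tab :=
    { entry := columnEntry L
      row_weak' := fun {i j1 j2} hj hm => by
        rw [mem_twoRowRect] at hm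
        have hp := List.pairwise_iff_getElem.mp (List.pairwise_reverse.mpr hL.sorted) j1 j2
          (by simp; omega) (by simp; omega) hj
        rw [columnEntry, columnEntry, dif_pos ⟨hm.1, hj.trans hm.2⟩, dif_pos hm]
        split_ifs
        · exact hp.1
        · exact hp.2
      col_strict' := fun {i1 i2 j} hi hm => by
        rw [mem_twoRowRect] at hm
        have h1 : i1 = 0 := by omega
        have h2 : i2 = 1 := by omega
        subst h1 h2
        rw [columnEntry, columnEntry, dif_pos ⟨by omega, hm.2⟩, dif_pos hm]
        exact hL.lt _ (List.mem_reverse.mp (List.getElem_mem _))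
      zeros' := fun {i j} hm => by
        rw [mem_twoRowRect] at hm
        exact dif_neg hm }
  entry_lt := fun i j hm => by
    rw [mem_twoRowRect] at hm
    change columnEntry L i j < n
    rw [columnEntry, dif_pos hm]
    exact Fin.isLt _

theorem IsColumnList.columnList_tableau {L : List (Fin n × Fin n)} (hL : IsColumnList L) :
    hL.tableau.columnList = L := by
  refine List.ext_getElem (by simp [TwoRowSSYT.columnList, IsColumnList.tableau]) fun j h1 h2 => ?_
  have h3 : L.length - 1 - (L.length - (j + 1)) = j := by omega
  have hl : ∀ i : Fin 2, (hL.tableau.letter i (Fin.rev ⟨j, h2⟩) : ℕ) =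
      columnEntry L i (L.length - (j + 1)) := fun i => rfl
  simp only [TwoRowSSYT.columnList, List.getElem_ofFn]
  refine Prod.ext (Fin.ext ?_) (Fin.ext ?_)
  · refine (hl 0).trans ?_
    rw [columnEntry, dif_pos ⟨by decide, by omega⟩]
    simp [h3]
  · refine (hl 1).trans ?_
    rw [columnEntry, dif_pos ⟨by decide, by omega⟩]
    simp [h3]

theorem columnSpan_eq (d : Fin n → ℕ) :
    columnSpan F d =
      Submodule.span F ((fun T : TwoRowSSYT n => T.poly F) '' boundedTableaux d) := by
  refine congrArg _ (Set.ext fun f => ⟨?_, ?_⟩)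
  · rintro ⟨L, hL, hc, rfl⟩
    refine ⟨hL.tableau, fun k => ?_, ?_⟩
    · rw [← columnCount_columnList, hL.columnList_tableau]
      exact hc k
    · change hL.tableau.poly F = _
      rw [← columnPoly_columnList, hL.columnList_tableau]
  · rintro ⟨T, hT, rfl⟩
    exact ⟨T.columnList, isColumnList_columnList T,
      fun k => (columnCount_columnList T k).trans_le (hT k), columnPoly_columnList T⟩

end Tableaux

end OneRow

theorem mainTheorem6 {F : Type*} [Field F] [CharZero F] (n : ℕ) (d : Fin n → ℕ) :
    OneRow.inverseSystem (OneRow.oneRowIdeal F d) =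
      Submodule.span F
        ((fun T : OneRow.TwoRowSSYT n => T.poly F) '' OneRow.boundedTableaux d) := by
  ext g
  rw [OneRow.mem_inverseSystem_iff, ← OneRow.columnSpan_eq]
  exact ⟨fun h => OneRow.mem_columnSpan_of_shiftDerivation_eq_zero h.1 h.2,
    OneRow.mem_columnSpan_imp⟩
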